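/- **Theorem 1.7.** Let $\mu$ be an infinite cardinal such that there is a Jónsson algebra on $\mu$ (an algebra with universe $\mu$ and countably many finitary operations which has no proper subalgebra of cardinality $\mu$), let $\lambda = 2^{\mu}$, and assume that $\mu$ is regular and $|\alpha|^{\aleph_0} < \mu$ for every ordinal $\alpha < \mu$. For a finite set $u$ let $\mathrm{pfil}(u)$ be the set of all $w \subseteq \mathcal P(u)$ such that $u \in w$, $w$ is upward closed in $\mathcal P(u)$, and whenever $u$ is the disjoint union of $u_1$ and $u_2$, then $u_1 \in w$ or $u_2 \in w$. A $\lambda$-candidate is a pair $(W, \mathbf w)$ where $W$ is a set of finite subsets of $\lambda$, $\mathbf w$ is a function with domain $W$, $\mathbf w(u) \in \mathrm{pfil}(u)$ for all $u \in W$, and for every finite $v \subseteq \lambda$ the set $\{u \in W : u \cap v \in \mathbf w(u)\}$ is finite. Let $BA(W, \mathbf w)$ be the Boolean algebra generated by $\{x_i : i < \lambda\}$ freely except for the relations $\bigcap_{i \in u} x_i = 0$ for $u \in W$, and let $BA^c(W, \mathbf w)$ be its completion. Then there is a $\lambda$-candidate $(W, \mathbf w)$ such that the complete Boolean algebra $\mathfrak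 B = BA^c(W, \mathbf w)$ and its generators $x_i$ ($i < \lambda$) satisfy: 1. $\mathfrak B$ satisfies the countable chain condition, that is, every set of pairwise disjoint nonzero elements of $\mathfrak B$ is countable; 2. $x_i \neq 0$ for all $i < \lambda$; 3. for each sequence $\langle (u_i, f_i) : i < \lambda\rangle$, where $u_i$ is a countable subset of $\lambda$ and $f_i : u_i \to \{0,1\}$, there are a natural number $n > 0$ and $i_0 < i_1 < \dots < i_{n-1} < \lambda$ such that the functions $f_{i_0}, \dots, f_{i_{n-1}}$ are compatible (any two of them agree on the intersection of their domains) and $\bigcap_{\ell < n} x_{i_\ell} = 0$ in $\mathfrak B$. -/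

import Mathlib

universe u

/-- `μ` carries a Jónsson algebra: an algebra with universe `μ` and countably many finitary
operations, none of whose proper subalgebras has cardinality `μ`. -/
def HasJonssonAlgebra (μ : Cardinal.{u}) : Prop :=
  ∃ (L : FirstOrder.Language.{0, 0}) (_ : L.IsAlgebraic) (_ : Countable (Σ n, L.Functions n))
    (_ : L.Structure μ.ord.ToType),
    ∀ S : L.Substructure μ.ord.ToType, Cardinal.mk S = μ → S = ⊤

/-- `w ∈ pfil(u)`: `w` is a pseudo-filter of subsets of the finite set `u`. -/
structure IsPseudoFilter {I : Type u} [DecidableEq I] (u : Finset I) (w : Set (Finset I)) :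
    Prop where
  subset : ∀ v ∈ w, v ⊆ u
  self_mem : u ∈ w
  upward : ∀ v ∈ w, ∀ v', v ⊆ v' → v' ⊆ u → v' ∈ w
  partition : ∀ u₁ u₂ : Finset I, Disjoint u₁ u₂ → u₁ ∪ u₂ = u → u₁ ∈ w ∨ u₂ ∈ w

/-- `(W, w)` is an `I`-candidate: `W` is a family of finite subsets of `I`, `w` is a function with
domain `W` which assigns a pseudo-filter to each member of `W`, and for every finite `v ⊆ I` the
set `{u ∈ W : u ∩ v ∈ w(u)}` is finite. -/
structure IsCandidate {I : Type u} [DecidableEq I] (W : Set (Finset I)) (w : W → Set (Finset I)) :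
    Prop where
  pfil : ∀ a : W, IsPseudoFilter (a : Finset I) (w a)
  finite_cl : ∀ v : Finset I, {a : W | (a : Finset I) ∩ v ∈ w a}.Finite

/-! ### The Boolean algebra of a candidate -/

/-- The relations of the Boolean ring: `x_i² = x_i` for all `i`, and `∏_{i ∈ a} x_i = 0` for
`a ∈ W`. -/
noncomputable def candidateIdeal {I : Type u} (W : Set (Finset I)) : Ideal (MvPolynomial I (ZMod 2)) :=
  Ideal.span ({p | ∃ i, p = MvPolynomial.X i ^ 2 - MvPolynomial.X i} ∪
    {p | ∃ a ∈ W, p = ∏ i ∈ a, MvPolynomial.X i})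

/-- The Boolean ring generated by `x_i` (`i ∈ I`) freely except `∏_{i ∈ a} x_i = 0` for
`a ∈ W`. -/
abbrev CandidateRing {I : Type u} (W : Set (Finset I)) : Type u :=
  MvPolynomial I (ZMod 2) ⧸ candidateIdeal W

theorem candidateRing_mul_self {I : Type u} (W : Set (Finset I)) (a : CandidateRing W) :
    a * a = a := by
  obtain ⟨p, rfl⟩ := Ideal.Quotient.mk_surjective a
  have h2 : ∀ z : CandidateRing W, z + z = 0 := by
    intro z
    obtain ⟨q, rfl⟩ := Ideal.Quotient.mk_surjective z
    rw [← map_add, CharTwo.add_self_eq_zero, map_zero]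
  induction p using MvPolynomial.induction_on with
  | C c =>
    rw [← map_mul, ← map_mul]
    congr 2
    revert c
    decide
  | add p q hp hq =>
    rw [map_add]
    linear_combination hp + hq + h2 (Ideal.Quotient.mk _ p * Ideal.Quotient.mk _ q)
  | mul_X p i hp =>
    have hX : Ideal.Quotient.mk (candidateIdeal W) (MvPolynomial.X i) *
        Ideal.Quotient.mk (candidateIdeal W) (MvPolynomial.X i) =
        Ideal.Quotient.mk (candidateIdeal W) (MvPolynomial.X i) := by
      rw [← map_mul, Ideal.Quotient.eq, ← pow_two]
      exact Ideal.subset_span (Or.inl ⟨i, rfl⟩)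
    rw [map_mul]
    linear_combination Ideal.Quotient.mk _ (MvPolynomial.X i) *
      Ideal.Quotient.mk _ (MvPolynomial.X i) * hp + Ideal.Quotient.mk _ p * hX

noncomputable instance candidateBooleanRing {I : Type u} (W : Set (Finset I)) : BooleanRing (CandidateRing W) where
  isIdempotentElem := candidateRing_mul_self W

/-- `BA(W, w)`: the Boolean algebra generated by `x_i` (`i ∈ I`) freely except
`⋂_{i ∈ a} x_i = 0` for `a ∈ W` (the relations do not involve `w`).  It is the Boolean algebra
that corresponds to the Boolean ring with these generators and relations. -/
abbrev CandidateBA {I : Type u} (W : Set (Finset I)) : Type u :=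
  AsBoolAlg (CandidateRing W)

/-- The generator `x_i` of `BA(W, w)`. -/
noncomputable def CandidateBA.gen {I : Type u} (W : Set (Finset I)) (i : I) : CandidateBA W :=
  toBoolAlg (Ideal.Quotient.mk (candidateIdeal W) (MvPolynomial.X i))

/-! ### The completion of a Boolean algebra

Mathlib's `DedekindCut B` is the Dedekind-MacNeille completion of `B`, as a complete lattice.  Here
it is made a complete Boolean algebra. -/

namespace DedekindCut

/-- The complement of a cut `(L, R)` is the cut `({bᶜ : b ∈ R}, {bᶜ : b ∈ L})`. -/
instance instComplOfBooleanAlgebra {B : Type u} [BooleanAlgebra B] : Compl (DedekindCut B) where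
  compl A :=
    { extent := {b | bᶜ ∈ A.right}
      intent := {b | bᶜ ∈ A.left}
      upperPolar_extent := by
        ext b
        rw [← A.lowerBounds_right]
        constructor
        · intro h c hc
          have := h (a := cᶜ) (by simpa using hc)
          exact compl_le_iff_compl_le.1 this
        · intro h c hc
          have : bᶜ ≤ cᶜ := h hc
          exact compl_le_compl_iff_le.1 this
      lowerPolar_intent := by
        ext b
        rw [← A.upperBounds_left]
        constructor
        · intro h c hc
          have := h (b := cᶜ) (by simpa using hc)
          exact le_compl_comm.1 this
        · intro h c hc
          have : cᶜ ≤ bᶜ := h hc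
          exact compl_le_compl_iff_le.1 this }

theorem mem_left_compl {B : Type u} [BooleanAlgebra B] {A : DedekindCut B} {b : B} :
    b ∈ (Aᶜ).left ↔ bᶜ ∈ A.right := Iff.rfl

theorem cut_compl_compl {B : Type u} [BooleanAlgebra B] (A : DedekindCut B) : Aᶜᶜ = A := by
  ext b
  change bᶜᶜ ∈ A.left ↔ b ∈ A.left
  rw [_root_.compl_compl]

theorem inf_le_bot_iff_le_compl {B : Type u} [BooleanAlgebra B] {A C : DedekindCut B} :
    A ⊓ C ≤ ⊥ ↔ A ≤ Cᶜ := by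
  have hbot : ∀ {D : DedekindCut B}, D ≤ ⊥ ↔ ∀ b ∈ D.left, b = ⊥ := by
    intro D
    constructor
    · intro h b hb
      have h1 : principal b ≤ principal (⊥ : B) :=
        (principal_le_iff.2 hb).trans (h.trans bot_le)
      exact le_bot_iff.1 (principal_le_principal.1 h1)
    · intro h
      rw [← Concept.extent_subset_extent_iff]
      intro b hb
      rw [h b hb]
      change ⊥ ∈ (⊥ : DedekindCut B).left
      rw [← lowerBounds_right]
      exact fun _ _ => bot_le
  have hdown : ∀ {D : DedekindCut B} {b c : B}, b ∈ D.left → c ≤ b → c ∈ D.left := by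
    intro D b c hb hc
    rw [← lowerBounds_right] at hb ⊢
    exact fun d hd => hc.trans (hb hd)
  rw [hbot]
  constructor
  · intro h
    rw [← Concept.extent_subset_extent_iff]
    intro b hb
    change bᶜ ∈ C.right
    rw [← upperBounds_left]
    intro c hc
    have h1 : b ⊓ c = ⊥ := h (b ⊓ c) ⟨hdown hb inf_le_left, hdown hc inf_le_right⟩
    exact (disjoint_iff.2 h1).symm.le_compl_right
  · rintro h b ⟨hA, hC⟩
    have h1 : bᶜ ∈ C.right := (Concept.extent_subset_extent_iff.2 h) hA
    rw [← upperBounds_left] at h1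
    have h2 : b ≤ bᶜ := h1 hC
    exact le_compl_self.1 h2

noncomputable instance instCompleteBooleanAlgebra {B : Type u} [BooleanAlgebra B] :
    CompleteBooleanAlgebra (DedekindCut B) where
  __ := (inferInstance : CompleteLattice (DedekindCut B))
  __ := instComplOfBooleanAlgebra
  le_sup_inf a b c := by
    have key : ∀ p q r : DedekindCut B, (p ⊔ q) ⊓ r ≤ (p ⊓ r) ⊔ (q ⊓ r) := by
      intro p q r
      set d := (p ⊓ r) ⊔ (q ⊓ r) with hd
      have hp : p ≤ (r ⊓ dᶜ)ᶜ := by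
        rw [← inf_le_bot_iff_le_compl, ← inf_assoc, inf_le_bot_iff_le_compl, cut_compl_compl]
        exact le_sup_left
      have hq : q ≤ (r ⊓ dᶜ)ᶜ := by
        rw [← inf_le_bot_iff_le_compl, ← inf_assoc, inf_le_bot_iff_le_compl, cut_compl_compl]
        exact le_sup_right
      have h := sup_le hp hq
      rwa [← inf_le_bot_iff_le_compl, ← inf_assoc, inf_le_bot_iff_le_compl, cut_compl_compl] at h
    calc (a ⊔ b) ⊓ (a ⊔ c) ≤ (a ⊓ (a ⊔ c)) ⊔ (b ⊓ (a ⊔ c)) := key _ _ _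
      _ ≤ a ⊔ ((a ⊓ b) ⊔ (c ⊓ b)) :=
        sup_le_sup inf_le_left (by rw [inf_comm b]; exact key _ _ _)
      _ ≤ a ⊔ b ⊓ c :=
        sup_le le_sup_left (sup_le (inf_le_left.trans le_sup_left)
          (by rw [inf_comm c]; exact le_sup_right))
  inf_compl_le_bot a := by
    rw [inf_le_bot_iff_le_compl, cut_compl_compl]
  top_le_sup_compl a := by
    have h1 : (a ⊔ aᶜ)ᶜ ≤ ⊥ := by
      have e1 : (a ⊔ aᶜ)ᶜ ≤ aᶜ := by
        rw [← inf_le_bot_iff_le_compl, inf_comm, inf_le_bot_iff_le_compl, cut_compl_compl]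
        exact le_sup_left
      have e2 : (a ⊔ aᶜ)ᶜ ≤ a := by
        conv_rhs => rw [← cut_compl_compl a]
        rw [← inf_le_bot_iff_le_compl, inf_comm, inf_le_bot_iff_le_compl, cut_compl_compl]
        exact le_sup_right
      have e3 : a ⊓ aᶜ ≤ ⊥ := by rw [inf_le_bot_iff_le_compl, cut_compl_compl]
      exact (le_inf e2 e1).trans e3
    rw [← cut_compl_compl (a ⊔ aᶜ), ← inf_le_bot_iff_le_compl]
    exact inf_le_right.trans h1

/-- The embedding of a Boolean algebra into its completion preserves complements. -/
theorem principal_compl {B : Type u} [BooleanAlgebra B] (b : B) :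
    principal bᶜ = (principal b)ᶜ := by
  ext c
  change c ≤ bᶜ ↔ b ≤ cᶜ
  exact le_compl_comm

/-- The embedding of a Boolean algebra into its completion preserves meets. -/
theorem principal_inf {B : Type u} [BooleanAlgebra B] (b c : B) :
    principal (b ⊓ c) = principal b ⊓ principal c := by
  ext d
  change d ≤ b ⊓ c ↔ d ≤ b ∧ d ≤ c
  exact le_inf_iff

/-- The embedding of a Boolean algebra into its completion preserves the least element. -/
theorem principal_bot {B : Type u} [BooleanAlgebra B] : principal (⊥ : B) = ⊥ :=
  le_bot_iff.1 (principal_le_iff.2 (by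
    rw [← lowerBounds_right]
    exact fun _ _ => bot_le))

/-- A Boolean algebra is dense in its completion. -/
theorem exists_principal_le {B : Type u} [BooleanAlgebra B] {A : DedekindCut B} (hA : A ≠ ⊥) :
    ∃ b : B, b ≠ ⊥ ∧ principal b ≤ A := by
  by_contra! h
  refine hA (le_bot_iff.1 ?_)
  rw [← principal_bot, ← Concept.extent_subset_extent_iff]
  intro b hb
  by_cases hb0 : b = ⊥
  · exact hb0.le
  · exact absurd (principal_le_iff.2 hb) (h b hb0)

end DedekindCut

/-- `BA^c(W, w)`: the completion of `BA(W, w)`, a complete Boolean algebra. -/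
abbrev CandidateBAc {I : Type u} (W : Set (Finset I)) : Type u :=
  DedekindCut (CandidateBA W)

/-- The generator `x_i`, as an element of `BA^c(W, w)`. -/
noncomputable def CandidateBAc.gen {I : Type u} (W : Set (Finset I)) (i : I) : CandidateBAc W :=
  DedekindCut.principal (CandidateBA.gen W i)

/-! ### The properties of the algebra -/

/-- The countable chain condition: every set of pairwise disjoint nonzero elements is countable. -/
def BooleanCCC (B : Type u) [BooleanAlgebra B] : Prop :=
  ∀ A : Set B, ⊥ ∉ A → A.Pairwise Disjoint → A.Countable

/-- The hypotheses on a complete Boolean algebra `B` and elements `x_i` (`i ∈ I`), where `I` is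
(the set of ordinals below) `λ`. -/
structure NoLiftingHypotheses {I : Type u} [LinearOrder I] (B : Type u) [CompleteBooleanAlgebra B]
    (x : I → B) : Prop where
  /-- `B` (which is complete) satisfies the countable chain condition. -/
  ccc : BooleanCCC B
  ne_zero : ∀ i, x i ≠ ⊥
  /-- For countable `u_i ⊆ λ` and functions `f_i : u_i → 2` there are `n > 0` and
  `i_0 < ... < i_{n-1}` such that the functions `f_{i_0}, ..., f_{i_{n-1}}` are compatible and
  `⋂_{l < n} x_{i_l} = 0`. -/
  compatible : ∀ (u : I → Set I) (f : ∀ i, u i → Bool), (∀ i, (u i).Countable) →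
    ∃ (n : ℕ) (s : Fin n → I), 0 < n ∧ StrictMono s ∧
      (∀ (k l : Fin n) (a : I) (hk : a ∈ u (s k)) (hl : a ∈ u (s l)),
        f (s k) ⟨a, hk⟩ = f (s l) ⟨a, hl⟩) ∧
      ⨅ k, x (s k) = ⊥

/-! The relations form a hypergraph on λ, which must be sparse enough for the countable chain
condition and rich enough that every assignment of countable partial functions has an edge with
compatible values. Since λ ^ μ = λ, the set λ splits into blocks of size μ indexed by pairs `(b,
z)`, where `b` runs over all functions from `Finset M × M` to λ and `z` numbers λ copies of each. An
edge is a finite set `s` in a block with `b` injective, together with the apex `b (s, ξ)`, where `ξ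
∈ Φ s`. The mapping `Φ` comes from the Jónsson algebra (`HasJonssonAlgebra.exists_set_mapping`):
every set of size μ contains, for each `ξ`, a finite `s` with `ξ ∈ Φ s`.

Sparseness: a base point fixes the block, and then the apex fixes the label. So the cones over bases
form a candidate (`exists_isCandidate_range`), and any candidate gives the chain condition by a
Δ-system and a free set (`IsCandidate.ccc`).

Richness (`BlockEdge.exists_compatible`): take a suitably closed set `U` of size at most μ. One
injective `b` lists, for each countable `p ⊆ U`, μ points whose graphs form a sunflower with kernel
`p`, if there are that many. A copy of the block for this `b` contains a Δ-system of size μ with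
some root `r`, and `ξ` is a code of `r ∩ U`. Block points and apices then clash only in their
petals, a free set removes these clashes, and the Jónsson property finds an edge inside the free
set. -/

/-! ### Regular cardinals and closure under small subsets. -/

open Cardinal in
/-- A family of fewer than `σ` members of a regular cardinal `σ` is strictly bounded. -/
theorem exists_forall_lt_of_mk_lt {σ : Cardinal.{u}} (hσ : σ.IsRegular) {ι : Type u}
    (hι : #ι < σ) (f : ι → σ.ord.ToType) : ∃ s, ∀ i, f i < s := by
  have h : ¬ IsCofinal (Set.range f) := by
    intro h
    have h1 := Order.cof_le h
    rw [Ordinal.cof_toType, hσ.cof_ord] at h1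
    exact absurd (h1.trans mk_range_le) (not_le.2 hι)
  simpa [IsCofinal] using h

open Cardinal in
theorem mk_iUnion_lt_of_isRegular {κ : Cardinal.{u}} (hκ : κ.IsRegular) {ι α : Type u}
    {t : ι → Set α} (hι : #ι < κ) (ht : ∀ i, #(t i) < κ) : #(⋃ i, t i) < κ :=
  (card_iUnion_lt_iff_forall_of_isRegular hκ hι).2 ht

open Cardinal in
theorem mk_union_lt_of_isRegular {κ : Cardinal.{u}} (hκ : κ.IsRegular) {α : Type u}
    {s t : Set α} (hs : #s < κ) (ht : #t < κ) : #(s ∪ t : Set α) < κ :=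
  (mk_union_le s t).trans_lt (add_lt_of_lt hκ.aleph0_le hs ht)

open Cardinal in
/-- Every set of size less than `κ` has fewer than `κ` subsets of size less than `σ`. -/
def FewSmallSubsets (κ σ : Cardinal.{u}) : Prop :=
  ∀ (J : Type u) (V : Set J), #V < κ → #{r : Set J // r ⊆ V ∧ #r < σ} < κ

open Cardinal in
theorem FewSmallSubsets.mk_iUnion_lt {κ σ : Cardinal.{u}} (h : FewSmallSubsets κ σ)
    (hκ : κ.IsRegular) {J K : Type u} {V : Set J} (hV : #V < κ) {Φ : Set J → Set K}
    (hΦ : ∀ r : Set J, #r < σ → #(Φ r) < κ) :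
    #(⋃ r : {r : Set J // r ⊆ V ∧ #r < σ}, Φ r.1) < κ :=
  mk_iUnion_lt_of_isRegular hκ (h J V hV) fun r => hΦ r r.2.2

open Cardinal in
/-- A closure operation on sets of size less than `σ` has a closed set of size less than `κ`. -/
theorem FewSmallSubsets.exists_closed {κ σ : Cardinal.{u}} (h : FewSmallSubsets κ σ)
    (hκ : κ.IsRegular) (hσ : σ.IsRegular) (hσκ : σ < κ) {J : Type u} (Φ : Set J → Set J)
    (hΦ : ∀ r : Set J, #r < σ → #(Φ r) < κ) :
    ∃ V : Set J, #V < κ ∧ ∀ r : Set J, r ⊆ V → #r < σ → Φ r ⊆ V := by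
  let S := σ.ord.ToType
  let step : Set J → Set J := fun V => V ∪ ⋃ r : {r : Set J // r ⊆ V ∧ #r < σ}, Φ r.1
  have hstep : ∀ V : Set J, #V < κ → #(step V) < κ := fun V hV =>
    mk_union_lt_of_isRegular hκ hV (h.mk_iUnion_lt hκ hV hΦ)
  let F : (s : S) → ((t : S) → t < s → Set J) → Set J :=
    fun s ih => ⋃ t : Set.Iio s, step (ih t t.2)
  let g : S → Set J := (wellFounded_lt (α := S)).fix F
  have hg : ∀ s, g s = ⋃ t : Set.Iio s, step (g t) := fun s => WellFounded.fix_eq _ F s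
  have hcard : ∀ s, #(g s) < κ := by
    intro s
    induction s using (wellFounded_lt (α := S)).induction with
    | _ s ih =>
      rw [hg]
      refine mk_iUnion_lt_of_isRegular hκ (LT.lt.trans (by simpa [S] using mk_Iio_lt s (by simp [S])) hσκ) ?_
      exact fun t => hstep _ (ih t t.2)
  have hsub : ∀ t s, t < s → step (g t) ⊆ g s := by
    intro t s hts
    rw [hg s]
    exact Set.subset_iUnion (fun t : Set.Iio s => step (g t)) ⟨t, hts⟩
  refine ⟨⋃ s, g s, mk_iUnion_lt_of_isRegular hκ (by simpa [S] using hσκ) hcard, ?_⟩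
  intro r hr hrσ
  have hr' : ∀ x : r, ∃ s, (x : J) ∈ g s := fun x => Set.mem_iUnion.1 (hr x.2)
  choose f hf using hr'
  obtain ⟨s, hs⟩ := exists_forall_lt_of_mk_lt hσ hrσ f
  -- `g s` collects only the steps applied to earlier stages, so `Φ r` appears at a stage strictly
  -- after `s`.
  obtain ⟨s', hs'⟩ := exists_forall_lt_of_mk_lt hσ (ι := PUnit)
    (by simpa using hσ.nat_lt 1) (fun _ => s)
  have hrs : r ⊆ g s := fun x hx => hsub _ _ (hs ⟨x, hx⟩) (Or.inl (hf ⟨x, hx⟩))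
  intro y hy
  refine Set.mem_iUnion.2 ⟨s', hsub _ _ (hs' PUnit.unit) (Or.inr ?_)⟩
  exact Set.mem_iUnion.2 ⟨⟨r, hrs, hrσ⟩, hy⟩

/-! ### Sunflowers, Δ-systems and free sets. -/

open Cardinal in
/-- `T` is a family of indices of supersets of `p` which are pairwise disjoint outside `p`, and
either `T` has size `κ`, or `T` is smaller than `κ` and maximal. -/
structure IsSunflowerOver (κ : Cardinal.{u}) {K J : Type u} (g : K → Set J) (p : Set J)
    (T : Set K) : Prop where
  subset : ∀ k ∈ T, p ⊆ g k
  disjoint : T.Pairwise fun k l => Disjoint (g k \ p) (g l \ p)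
  mk_le : #T ≤ κ
  maximal : #T < κ → ∀ k ∉ T, p ⊆ g k → ∃ l ∈ T, ¬ Disjoint (g k \ p) (g l \ p)

open Cardinal in
theorem exists_isSunflowerOver (κ : Cardinal.{u}) {K J : Type u} (g : K → Set J) (p : Set J) :
    ∃ T, IsSunflowerOver κ g p T := by
  let P : Set K → Prop := fun T => (∀ k ∈ T, p ⊆ g k) ∧
    T.Pairwise fun k l => Disjoint (g k \ p) (g l \ p)
  obtain ⟨T, hT⟩ : ∃ T, Maximal P T := by
    obtain ⟨T, -, hT⟩ := zorn_subset_nonempty {T | P T} (fun c hc hchain _ =>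
      ⟨⋃₀ c, ⟨fun k ⟨t, ht, hk⟩ => (hc ht).1 k hk,
        (Set.pairwise_sUnion hchain.directedOn).2 fun t ht => (hc ht).2⟩,
        fun t ht => Set.subset_sUnion_of_mem ht⟩) ∅ ⟨by simp, by simp⟩
    exact ⟨T, hT⟩
  rcases lt_or_ge (#T) κ with h | h
  · refine ⟨T, hT.prop.1, hT.prop.2, h.le, fun _ k hk hpk => ?_⟩
    by_contra! hdis
    have hins : P (insert k T) := by
      refine ⟨?_, ?_⟩
      · rintro l (rfl | hl)
        · exact hpk
        · exact hT.prop.1 l hl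
      · refine (Set.pairwise_insert.2 ⟨hT.prop.2, fun l hl _ => ⟨hdis l hl, (hdis l hl).symm⟩⟩)
    exact hk (hT.le_of_ge hins (Set.subset_insert k T) (Set.mem_insert k T))
  · obtain ⟨T', hT', hcard⟩ := Cardinal.le_mk_iff_exists_subset.1 h
    exact ⟨T', fun k hk => hT.prop.1 k (hT' hk), hT.prop.2.mono hT', hcard.le,
      fun hlt => absurd hcard hlt.ne⟩

open Cardinal in
/-- The `Δ`-system lemma. -/
theorem FewSmallSubsets.exists_delta_system {κ σ : Cardinal.{u}} (h : FewSmallSubsets κ σ)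
    (hκ : κ.IsRegular) (hσ : σ.IsRegular) (hσκ : σ < κ) {K J : Type u} (hK : κ ≤ #K)
    (g : K → Set J) (hg : ∀ k, #(g k) < σ) :
    ∃ (X : Set K) (r : Set J), #X = κ ∧ (∀ k ∈ X, r ⊆ g k) ∧
      X.Pairwise fun k l => Disjoint (g k \ r) (g l \ r) := by
  choose T hT using exists_isSunflowerOver κ g
  by_contra! hno
  have hlt : ∀ p : Set J, #(T p) < κ := fun p =>
    lt_of_le_of_ne (hT p).mk_le fun he => hno (T p) p he (hT p).subset (hT p).disjoint
  -- If all sunflowers are small, some `k` lies in none of those with small kernel inside `V`. With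
  -- kernel `g k ∩ V`, maximality makes the petal of `k` meet `V`, which is absurd.
  obtain ⟨V, hV, hclosed⟩ := h.exists_closed hκ hσ hσκ (fun p => ⋃ l : T p, g l)
    (fun p _ => mk_iUnion_lt_of_isRegular hκ (hlt p) fun l => (hg l).trans hσκ)
  have hE : #(⋃ r : {r : Set J // r ⊆ V ∧ #r < σ}, T r.1) < κ :=
    h.mk_iUnion_lt hκ hV fun p _ => hlt p
  obtain ⟨k, hk⟩ : ∃ k, k ∉ ⋃ r : {r : Set J // r ⊆ V ∧ #r < σ}, T r.1 := by
    by_contra! hall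
    rw [Set.eq_univ_of_forall hall, mk_univ] at hE
    exact absurd hK (not_le.2 hE)
  have hr : #(g k ∩ V : Set J) < σ := (mk_le_mk_of_subset Set.inter_subset_left).trans_lt (hg k)
  have hkT : k ∉ T (g k ∩ V) := fun hk' =>
    hk (Set.mem_iUnion.2 ⟨⟨g k ∩ V, Set.inter_subset_right, hr⟩, hk'⟩)
  obtain ⟨l, hl, hdis⟩ := (hT (g k ∩ V)).maximal (hlt _) k hkT Set.inter_subset_left
  obtain ⟨x, hx, hx'⟩ := Set.not_disjoint_iff.1 hdis
  have hxV : x ∈ V := hclosed _ Set.inter_subset_right hr (Set.mem_iUnion.2 ⟨⟨l, hl⟩, hx'.1⟩)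
  exact hx.2 ⟨hx.1, hxV⟩

open Cardinal in
/-- The free set lemma. -/
theorem FewSmallSubsets.exists_free {κ σ : Cardinal.{u}} (h : FewSmallSubsets κ σ)
    (hκ : κ.IsRegular) (hσ : σ.IsRegular) (hσκ : σ < κ) {K : Type u} (hK : κ ≤ #K)
    (G : K → Set K) (hG : ∀ k, #(G k) < σ) :
    ∃ X : Set K, #X = κ ∧ X.Pairwise fun k l => l ∉ G k := by
  obtain ⟨X, r, hX, hr, hdis⟩ := h.exists_delta_system hκ hσ hσκ hK
    -- With each index added to its own set, `l ∈ G k` puts `l` into both petals as soon as `l` is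
    -- outside the root.
    (fun k => insert k (G k))
    (fun k => (mk_insert_le).trans_lt (add_lt_of_lt hσ.aleph0_le (hG k) (by simpa using hσ.nat_lt 1)))
  have hXr : κ ≤ #(X \ r : Set K) := by
    by_contra! hlt
    have hrκ : #r < κ := by
      have : X.Nonempty := by
        rw [← Set.nonempty_coe_sort, ← mk_ne_zero_iff, hX]
        exact hκ.ne_zero
      obtain ⟨k, hk⟩ := this
      refine (mk_le_mk_of_subset (hr k hk)).trans_lt ?_
      exact (mk_insert_le).trans_lt
        (add_lt_of_lt hκ.aleph0_le ((hG k).trans hσκ) (by simpa using hκ.nat_lt 1))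
    have h1 := mk_union_lt_of_isRegular hκ hlt hrκ
    refine absurd (mk_le_mk_of_subset (?_ : X ⊆ X \ r ∪ r)) (not_le.2 (hX ▸ h1))
    rw [Set.sdiff_union_self]
    exact Set.subset_union_left
  obtain ⟨Y, hY, hYκ⟩ := Cardinal.le_mk_iff_exists_subset.1 hXr
  refine ⟨Y, hYκ, fun k hk l hl hkl hlG => ?_⟩
  exact Set.disjoint_left.1 (hdis (hY hk).1 (hY hl).1 hkl)
    (⟨Or.inr hlG, (hY hl).2⟩ : l ∈ insert k (G k) \ r) ⟨Set.mem_insert _ _, (hY hl).2⟩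

open Cardinal in
theorem FewSmallSubsets.exists_free_subset {κ σ : Cardinal.{u}} (h : FewSmallSubsets κ σ)
    (hκ : κ.IsRegular) (hσ : σ.IsRegular) (hσκ : σ < κ) {K : Type u} {X : Set K} (hX : κ ≤ #X)
    (G : K → Set K) (hG : ∀ k ∈ X, #(G k ∩ X : Set K) < σ) :
    ∃ Y ⊆ X, #Y = κ ∧ Y.Pairwise fun k l => l ∉ G k := by
  obtain ⟨Y, hY, hfree⟩ := h.exists_free hκ hσ hσκ hX (fun k : X => (↑) ⁻¹' G k) fun k => by
    refine lt_of_le_of_lt ?_ (hG k k.2)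
    rw [← mk_image_eq Subtype.val_injective, Subtype.image_preimage_coe, Set.inter_comm]
  refine ⟨(↑) '' Y, Subtype.coe_image_subset X Y, ?_, ?_⟩
  · rw [mk_image_eq Subtype.val_injective, hY]
  · rintro _ ⟨k, hk, rfl⟩ _ ⟨l, hl, rfl⟩ hkl
    exact hfree hk hl fun he => hkl (congrArg _ he)

open Cardinal in
/-- A set meets at most as many members of a disjoint family as it has elements. -/
theorem mk_setOf_not_disjoint_le {K J : Type u} {X : Set K} {g : K → Set J}
    (hdis : X.Pairwise fun k l => Disjoint (g k) (g l)) (E : Set J) :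
    #{l ∈ X | ¬ Disjoint E (g l)} ≤ #E := by
  have h : ∀ l : {l ∈ X | ¬ Disjoint E (g l)}, ∃ x : E, (x : J) ∈ g l := by
    rintro ⟨l, -, hl⟩
    obtain ⟨x, hx, hxl⟩ := Set.not_disjoint_iff.1 hl
    exact ⟨⟨x, hx⟩, hxl⟩
  choose f hf using h
  refine ⟨⟨f, fun k l hkl => ?_⟩⟩
  by_contra hne
  exact Set.disjoint_left.1 (hdis k.2.1 l.2.1 fun he => hne (Subtype.ext he)) (hf k) (hkl ▸ hf l)

/-! ### Counting small subsets. -/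

open Cardinal in
theorem mk_small_subsets_lt_of_mk_le {κ σ : Cardinal.{u}} {J K : Type u} {V : Set J} {V' : Set K}
    (h : #V ≤ #V') (h' : #{r : Set K // r ⊆ V' ∧ #r < σ} < κ) :
    #{r : Set J // r ⊆ V ∧ #r < σ} < κ := by
  refine lt_of_le_of_lt ?_ h'
  obtain ⟨f⟩ := h
  have hinj : Function.Injective fun x : V => (f x : K) :=
    Subtype.val_injective.comp f.injective
  refine ⟨⟨fun r => ⟨(fun x : V => (f x : K)) '' ((↑) ⁻¹' r.1), ?_, ?_⟩, ?_⟩⟩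
  · rintro _ ⟨x, -, rfl⟩
    exact (f x).2
  · refine mk_image_le.trans_lt (lt_of_le_of_lt ?_ r.2.2)
    exact mk_preimage_of_injective _ _ Subtype.val_injective
  · intro r s hrs
    have h1 := hinj.image_injective (congrArg Subtype.val hrs)
    ext x
    constructor
    · intro hx
      have : (⟨x, r.2.1 hx⟩ : V) ∈ ((↑) ⁻¹' s.1 : Set V) := h1 ▸ hx
      exact this
    · intro hx
      have : (⟨x, s.2.1 hx⟩ : V) ∈ ((↑) ⁻¹' r.1 : Set V) := h1 ▸ hx
      exact this

open Cardinal in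
theorem fewSmallSubsets_aleph_one_aleph0 : FewSmallSubsets.{u} ℵ₁ ℵ₀ := by
  intro J V hV
  have hV' : V.Countable := by
    rw [← Cardinal.le_aleph0_iff_set_countable]
    rwa [← succ_aleph0, Order.lt_succ_iff] at hV
  rw [← succ_aleph0, Order.lt_succ_iff, Cardinal.mk_le_aleph0_iff]
  have : Set.Countable {r : Set J | r ⊆ V ∧ #r < ℵ₀} := by
    refine (Set.countable_ofPred_finite_subset hV').mono ?_
    rintro r ⟨h1, h2⟩
    exact ⟨lt_aleph0_iff_set_finite.1 h2, h1⟩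
  exact this.to_subtype

open Cardinal in
theorem mk_countable_subset_le {J : Type u} (V : Set J) :
    #{r : Set J // r ⊆ V ∧ #r < ℵ₁} ≤ max (#V) ℵ₀ ^ (ℵ₀ : Cardinal.{u}) := by
  refine le_trans ?_ (mk_bounded_subset_le V ℵ₀)
  simp only [← succ_aleph0, Order.lt_succ_iff]
  exact le_rfl

open Cardinal in
theorem fewSmallSubsets_of_power_lt {μ : Cardinal.{u}} (hμ : ℵ₀ < μ)
    (hpow : ∀ ν < μ, ν ^ (ℵ₀ : Cardinal.{u}) < μ) : FewSmallSubsets μ ℵ₁ := fun _ V hV =>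
  (mk_countable_subset_le V).trans_lt (hpow _ (max_lt hV hμ))

-- By regularity, countable subsets of μ are bounded, so there are at most μ · μ of them.
open Cardinal in
theorem fewSmallSubsets_succ {μ : Cardinal.{u}} (hμ : μ.IsRegular)
    (hμ₁ : ℵ₁ < μ) (h : FewSmallSubsets μ ℵ₁) : FewSmallSubsets (Order.succ μ) ℵ₁ := by
  intro J V hV
  rw [Order.lt_succ_iff] at hV
  let M := μ.ord.ToType
  have hM : #M = μ := by simp [M]
  refine mk_small_subsets_lt_of_mk_le (V' := (Set.univ : Set M)) (by simpa [hM] using hV) ?_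
  rw [Order.lt_succ_iff]
  have hb : ∀ r : {r : Set M // r ⊆ Set.univ ∧ #r < ℵ₁}, ∃ s : M, r.1 ⊆ Set.Iio s := by
    intro r
    obtain ⟨s, hs⟩ := exists_forall_lt_of_mk_lt hμ (r.2.2.trans hμ₁) (fun x : r.1 => (x : M))
    exact ⟨s, fun x hx => hs ⟨x, hx⟩⟩
  choose f hf using hb
  calc #{r : Set M // r ⊆ Set.univ ∧ #r < ℵ₁}
      ≤ #(Σ s : M, {r : Set M // r ⊆ Set.Iio s ∧ #r < ℵ₁}) := by
        refine ⟨⟨fun r => ⟨f r, r.1, hf r, r.2.2⟩, fun r r' hrr => ?_⟩⟩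
        have := congrArg (fun x => x.2.1) hrr
        exact Subtype.ext this
    _ = sum fun s : M => #{r : Set M // r ⊆ Set.Iio s ∧ #r < ℵ₁} := mk_sigma _
    _ ≤ sum fun _ : M => μ := sum_le_sum _ _ fun s =>
        (h M _ (by simpa [M] using mk_Iio_lt s (by simp [M]))).le
    _ = μ := by simp [hM, mul_eq_self hμ.aleph0_le]

/-! ### Set mappings from Jónsson algebras, and distinct representatives. -/

open Cardinal FirstOrder.Language in
theorem exists_finset_mem_closure {L : FirstOrder.Language.{0, 0}} {M : Type u} [L.Structure M]
    {X : Set M} {x : M} (hx : x ∈ Substructure.closure L X) :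
    ∃ s : Finset M, ↑s ⊆ X ∧ x ∈ Substructure.closure L (s : Set M) := by
  classical
  refine Substructure.closure_induction
    (p := fun x => ∃ s : Finset M, ↑s ⊆ X ∧ x ∈ Substructure.closure L (s : Set M)) hx ?_ ?_
  · exact fun x hx => ⟨{x}, by simpa using hx, Substructure.subset_closure (by simp)⟩
  · intro n f x hx
    choose t ht ht' using hx
    refine ⟨Finset.univ.biUnion t, by simpa using ht, ?_⟩
    refine Substructure.fun_mem _ f x fun i => ?_
    refine Substructure.closure_mono ?_ (ht' i)
    exact_mod_cast Finset.subset_biUnion_of_mem t (Finset.mem_univ i)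

open Cardinal FirstOrder.Language in
theorem HasJonssonAlgebra.exists_set_mapping {μ : Cardinal.{u}} (hJ : HasJonssonAlgebra μ)
    (hμ : ℵ₀ ≤ μ) : ∃ Φ : Finset μ.ord.ToType → Finset μ.ord.ToType,
      ∀ X : Set μ.ord.ToType, #X = μ → ∀ ξ, ∃ s : Finset μ.ord.ToType,
        ↑s ⊆ X ∧ 2 ≤ s.card ∧ ξ ∈ Φ s := by
  classical
  obtain ⟨L, _, _, _, hS⟩ := hJ
  have : Nonempty μ.ord.ToType := by
    rw [← mk_ne_zero_iff, mk_ord_toType]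
    exact (aleph0_pos.trans_le hμ).ne'
  have hv : ∀ s : Finset μ.ord.ToType, ∃ v : ℕ → μ.ord.ToType,
      (Substructure.closure L (s : Set μ.ord.ToType) : Set μ.ord.ToType) ⊆ Set.range v := fun s =>
    Set.countable_iff_exists_subset_range.1
      (Set.countable_coe_iff.1 (s.countable_toSet.substructure_closure L))
  choose v hv using hv
  -- The closure of `t` may be infinite. Cutting its enumeration at the size of `s` keeps `Φ s`
  -- finite, and enlarging `s` inside `X` reaches any given entry.
  refine ⟨fun s => s.powerset.biUnion fun t => (Finset.range (s.card + 1)).image (v t), ?_⟩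
  intro X hX ξ
  have htop : Substructure.closure L X = ⊤ := by
    refine hS _ (le_antisymm ?_ ?_)
    · exact (mk_set_le _).trans (mk_ord_toType μ).le
    · exact hX.symm.le.trans (mk_le_mk_of_subset Substructure.subset_closure)
  obtain ⟨t, htX, ht⟩ := exists_finset_mem_closure (htop ▸ Substructure.mem_top ξ)
  obtain ⟨n, hn⟩ := hv t ht
  have hXinf : X.Infinite := by
    rw [← Set.infinite_coe_iff, infinite_iff, hX]
    exact hμ
  obtain ⟨t', ht'X, ht'⟩ := hXinf.exists_subset_card_eq (n + 2)
  have hcard : n + 2 ≤ (t ∪ t').card := ht' ▸ Finset.card_le_card Finset.subset_union_right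
  refine ⟨t ∪ t', by simp [htX, ht'X], by omega, ?_⟩
  refine Finset.mem_biUnion.2 ⟨t, Finset.mem_powerset.2 Finset.subset_union_left, ?_⟩
  exact Finset.mem_image.2 ⟨n, Finset.mem_range.2 (by omega), hn⟩

open Cardinal in
/-- Sets `T k` (`k ∈ K`) of size at least `#K` have a system of distinct representatives. -/
theorem exists_injective_choice {K I : Type u} (T : K → Set I) (hT : ∀ k, #K ≤ #(T k)) :
    ∃ b : K → I, Function.Injective b ∧ ∀ k, b k ∈ T k := by
  obtain ⟨e⟩ : Nonempty (K ≃ (#K).ord.ToType) := Cardinal.eq.1 (by simp)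
  let S := (#K).ord.ToType
  -- Along an initial ordinal, fewer than `#K` representatives are in use at each stage.
  have hex : ∀ (s : S) (ih : (t : S) → t < s → I), ∃ x ∈ T (e.symm s), ∀ t ht, ih t ht ≠ x := by
    intro s ih
    by_contra! hall
    have hsub : T (e.symm s) ⊆ Set.range fun t : Set.Iio s => ih t t.2 := by
      intro x hx
      obtain ⟨t, ht, rfl⟩ := hall x hx
      exact ⟨⟨t, ht⟩, rfl⟩
    have h1 := (hT (e.symm s)).trans ((mk_le_mk_of_subset hsub).trans mk_range_le)
    exact absurd h1 (not_le.2 (by simpa [S] using mk_Iio_lt s (by simp [S])))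
  choose F hF hF' using hex
  let b : S → I := (wellFounded_lt (α := S)).fix F
  have hb : ∀ s, b s = F s fun t _ => b t := fun s => WellFounded.fix_eq _ F s
  have hlt : ∀ t s, t < s → b t ≠ b s := by
    intro t s hts
    rw [hb s]
    exact hF' s (fun t _ => b t) t hts
  refine ⟨fun k => b (e k), ?_, fun k => ?_⟩
  · refine Function.Injective.comp (g := b) (fun s t hst => ?_) e.injective
    rcases lt_trichotomy s t with h | h | h
    · exact absurd hst (hlt s t h)
    · exact h
    · exact absurd hst.symm (hlt t s h)
  · have := hF (e k) fun t _ => b t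
    rw [← hb, e.symm_apply_apply] at this
    exact this

/-! ### Points of the Stone space and generators of the completion. -/

/-- A set `c` of generators is admissible if it contains no member of `W`. -/
def IsAdmissible {I : Type u} (W : Set (Finset I)) (c : Set I) : Prop :=
  ∀ a ∈ W, ¬ (a : Set I) ⊆ c

namespace CandidateRing

open Classical in
/-- The point of the Stone space of the algebra given by an admissible set. -/
noncomputable def evalAt {I : Type u} {W : Set (Finset I)} {c : Set I} (hc : IsAdmissible W c) :
    CandidateRing W →+* ZMod 2 :=
  Ideal.Quotient.lift (candidateIdeal W)
    (MvPolynomial.eval fun i => if i ∈ c then (1 : ZMod 2) else 0) <| by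
      change ∀ p ∈ candidateIdeal W, p ∈ RingHom.ker _
      refine Ideal.span_le.2 ?_
      rintro _ (⟨i, rfl⟩ | ⟨a, ha, rfl⟩)
      · by_cases hi : i ∈ c <;> simp [hi]
      · obtain ⟨i, hi, hic⟩ := Set.not_subset.1 (hc a ha)
        simp only [SetLike.mem_coe, RingHom.mem_ker, map_prod, MvPolynomial.eval_X]
        exact Finset.prod_eq_zero hi (by simp [hic])

open Classical in
theorem evalAt_mk {I : Type u} {W : Set (Finset I)} {c : Set I} (hc : IsAdmissible W c)
    (p : MvPolynomial I (ZMod 2)) : evalAt hc (Ideal.Quotient.mk _ p) =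
      MvPolynomial.eval (fun i => if i ∈ c then (1 : ZMod 2) else 0) p :=
  Ideal.Quotient.lift_mk _ _ _

open Classical in
/-- An element of the algebra depends on finitely many generators. -/
theorem exists_support {I : Type u} {W : Set (Finset I)} (q : CandidateRing W) :
    ∃ V : Finset I, ∀ (c c' : Set I) (hc : IsAdmissible W c) (hc' : IsAdmissible W c'),
      (∀ i ∈ V, i ∈ c ↔ i ∈ c') → evalAt hc q = evalAt hc' q := by
  obtain ⟨p, rfl⟩ := Ideal.Quotient.mk_surjective q
  refine ⟨p.vars, fun c c' hc hc' h => ?_⟩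
  rw [evalAt_mk, evalAt_mk]
  refine MvPolynomial.eval₂Hom_congr' rfl (fun i hi _ => ?_) rfl
  exact if_congr (h i hi) rfl rfl

/-- The points given by admissible sets separate the elements of the algebra from zero. -/
theorem exists_evalAt_ne_zero {I : Type u} {W : Set (Finset I)} {q : CandidateRing W}
    (hq : q ≠ 0) : ∃ (c : Set I) (hc : IsAdmissible W c), evalAt hc q ≠ 0 := by
  classical
  -- A Boolean ring is reduced, so some prime ideal misses `q`; the generators outside it form the
  -- admissible set.
  have hq' : q ∉ nilradical (CandidateRing W) := by
    rintro ⟨n, hn⟩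
    have hpow : ∀ n, q ^ (n + 1) = q := by
      intro n
      induction n with
      | zero => exact pow_one q
      | succ n ih => rw [pow_succ, ih, candidateRing_mul_self]
    cases n with
    | zero => exact hq (by rw [← mul_one q, ← pow_zero q, hn, mul_zero])
    | succ n => exact hq (by rw [← hpow n, hn])
  rw [nilradical_eq_sInf, Submodule.mem_sInf] at hq'
  push Not at hq'
  obtain ⟨(P : Ideal (CandidateRing W)), hP, hqP⟩ := hq'
  have hP' : P.IsPrime := hP
  let x : I → CandidateRing W := fun i => Ideal.Quotient.mk _ (MvPolynomial.X i)
  obtain ⟨c, hcP⟩ : ∃ c : Set I, ∀ i, i ∈ c ↔ x i ∉ P := ⟨{i | x i ∉ P}, fun _ => Iff.rfl⟩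
  have hc : IsAdmissible W c := by
    intro a ha hac
    have h0 : ∏ i ∈ a, x i = 0 := by
      rw [← map_prod, Ideal.Quotient.eq_zero_iff_mem]
      exact Ideal.subset_span (Or.inr ⟨a, ha, rfl⟩)
    obtain ⟨i, hi, hiP⟩ := hP'.prod_mem_iff.1 (h0 ▸ P.zero_mem)
    exact (hcP i).1 (hac hi) hiP
  refine ⟨c, hc, fun h0 => hqP ?_⟩
  let ψ := (Ideal.Quotient.mk P).comp (Ideal.Quotient.mk (candidateIdeal W))
  -- Modulo a prime, an idempotent is 0 or 1, so the quotient map factors through evaluation at `c`.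
  have hψ : ψ = (ψ.comp MvPolynomial.C).comp
      (MvPolynomial.eval fun i => if i ∈ c then (1 : ZMod 2) else 0) := by
    refine MvPolynomial.ringHom_ext (fun r => by simp) fun i => ?_
    by_cases hi : i ∈ c
    · have h1 : ψ (MvPolynomial.X i) * ψ (MvPolynomial.X i) = ψ (MvPolynomial.X i) := by
        have := congrArg (Ideal.Quotient.mk P) (candidateRing_mul_self W (x i))
        rwa [map_mul] at this
      have h2 : ψ (MvPolynomial.X i) ≠ 0 := fun h =>
        (hcP i).1 hi (Ideal.Quotient.eq_zero_iff_mem.1 h)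
      simpa [hi] using mul_left_cancel₀ h2 (h1.trans (mul_one _).symm)
    · have : ψ (MvPolynomial.X i) = 0 := 
        Ideal.Quotient.eq_zero_iff_mem.2 (not_not.1 (mt (hcP i).2 hi))
      simpa [hi] using this
  obtain ⟨p, rfl⟩ := Ideal.Quotient.mk_surjective q
  rw [evalAt_mk] at h0
  have h3 : ψ p = 0 := by
    rw [hψ, RingHom.comp_apply, h0, map_zero]
  exact Ideal.Quotient.eq_zero_iff_mem.1 h3

end CandidateRing

theorem DedekindCut.principal_ne_bot {B : Type u} [BooleanAlgebra B] {b : B} (hb : b ≠ ⊥) :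
    principal b ≠ ⊥ := by
  rw [← principal_bot]
  exact fun h => hb (le_bot_iff.1 (principal_le_principal.1 h.le))

theorem CandidateBAc.gen_ne_bot {I : Type u} {W : Set (Finset I)} {i : I}
    (h : IsAdmissible W {i}) : CandidateBAc.gen W i ≠ ⊥ := by
  refine DedekindCut.principal_ne_bot fun h0 => ?_
  have h1 : Ideal.Quotient.mk (candidateIdeal W) (MvPolynomial.X i) = 0 := h0
  have h2 := CandidateRing.evalAt_mk h (MvPolynomial.X i)
  rw [h1] at h2
  simp at h2

theorem CandidateBA.ofBoolAlg_inf_gen {I : Type u} (W : Set (Finset I)) (a : Finset I) :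
    ofBoolAlg (a.inf (CandidateBA.gen W)) =
      Ideal.Quotient.mk (candidateIdeal W) (∏ i ∈ a, MvPolynomial.X i) := by
  classical
  induction a using Finset.induction_on with
  | empty => simp
  | insert i a hi ih =>
    rw [Finset.inf_insert, ofBoolAlg_inf, ih, Finset.prod_insert hi, map_mul]
    rfl

/-- By density, a nonzero lower bound in the completion would give one in the original algebra,
where the relation forbids it. -/
theorem CandidateBAc.inf_gen_eq_bot {I : Type u} {W : Set (Finset I)} {a : Finset I}
    (ha : a ∈ W) : ⨅ i ∈ a, CandidateBAc.gen W i = ⊥ := by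
  have h0 : a.inf (CandidateBA.gen W) = ⊥ := by
    rw [← ofBoolAlg_inj, CandidateBA.ofBoolAlg_inf_gen, ofBoolAlg_bot,
      Ideal.Quotient.eq_zero_iff_mem]
    exact Ideal.subset_span (Or.inr ⟨a, ha, rfl⟩)
  refine le_bot_iff.1 (not_not.1 fun hne => ?_)
  obtain ⟨b, hb, hle⟩ := DedekindCut.exists_principal_le fun h => hne h.le
  refine hb (le_bot_iff.1 (h0 ▸ Finset.le_inf fun i hi => ?_))
  exact DedekindCut.principal_le_principal.1 (hle.trans (iInf₂_le i hi))

theorem IsAdmissible.mono {I : Type u} {W : Set (Finset I)} {c c' : Set I}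
    (hc : IsAdmissible W c) (h : c' ⊆ c) : IsAdmissible W c' :=
  fun a ha hac => hc a ha (hac.trans h)

open Classical in
/-- A nonzero element of the algebra takes the value `1` at all admissible sets with a given
trace on a given finite set. -/
theorem CandidateBA.exists_trace {I : Type u} {W : Set (Finset I)} {b : CandidateBA W}
    (hb : b ≠ ⊥) : ∃ V a : Finset I, a ⊆ V ∧ IsAdmissible W (a : Set I) ∧
      ∀ (c : Set I) (hc : IsAdmissible W c), (∀ i ∈ V, i ∈ c ↔ i ∈ a) →
        CandidateRing.evalAt hc (ofBoolAlg b) ≠ 0 := by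
  have hb' : ofBoolAlg b ≠ 0 := fun h => hb (by rwa [← ofBoolAlg_bot, ofBoolAlg_inj] at h)
  obtain ⟨c, hc, hne⟩ := CandidateRing.exists_evalAt_ne_zero hb'
  obtain ⟨V, hV⟩ := CandidateRing.exists_support (ofBoolAlg b)
  refine ⟨V, V.filter (· ∈ c), Finset.filter_subset _ _, hc.mono fun i hi => ?_, ?_⟩
  · exact (Finset.mem_filter.1 hi).2
  · intro c' hc' h
    rwa [hV c' c hc' hc fun i hi => by rw [h i hi]; simp [hi]]

/-! ### Graphs of partial functions and compatibility. -/

/-- The graph of a partial function to `Bool`. -/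
def boolGraph {I : Type u} (s : Set I) (f : s → Bool) : Set (I × Bool) :=
  Set.range fun i : s => (i.1, f i)

theorem mem_boolGraph {I : Type u} {s : Set I} {f : s → Bool} {x : I × Bool} :
    x ∈ boolGraph s f ↔ ∃ h : x.1 ∈ s, f ⟨x.1, h⟩ = x.2 := by
  constructor
  · rintro ⟨i, rfl⟩
    exact ⟨i.2, rfl⟩
  · rintro ⟨h, hx⟩
    exact ⟨⟨x.1, h⟩, Prod.ext rfl hx⟩

/-- The set of pairs that contradict a pair in `g`. -/
def contradicting {I : Type u} (g : Set (I × Bool)) : Set (I × Bool) :=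
  (fun x => (x.1, !x.2)) '' g

theorem not_mem_contradicting {I : Type u} {s : Set I} {f : s → Bool} {x : I × Bool}
    (hx : x ∈ boolGraph s f) : x ∉ contradicting (boolGraph s f) := by
  rintro ⟨y, hy, rfl⟩
  obtain ⟨h, h'⟩ := mem_boolGraph.1 hx
  obtain ⟨_, h''⟩ := mem_boolGraph.1 hy
  exact Bool.not_ne_self _ (h'.symm.trans h'')

theorem eq_of_disjoint_contradicting {I : Type u} {s t : Set I} {f : s → Bool} {g : t → Bool}
    (h : Disjoint (contradicting (boolGraph s f)) (boolGraph t g)) (i : I) (hs : i ∈ s)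
    (ht : i ∈ t) : f ⟨i, hs⟩ = g ⟨i, ht⟩ := by
  by_contra hne
  have h1 : (i, !f ⟨i, hs⟩) ∈ contradicting (boolGraph s f) :=
    ⟨(i, f ⟨i, hs⟩), mem_boolGraph.2 ⟨hs, rfl⟩, rfl⟩
  refine Set.disjoint_left.1 h h1 (mem_boolGraph.2 ⟨ht, ?_⟩)
  exact Bool.eq_not_of_ne fun h => hne h.symm

/-! ### The countable chain condition. -/

open Cardinal in
theorem IsCandidate.ccc {I : Type u} [DecidableEq I] {W : Set (Finset I)}
    {w : W → Set (Finset I)} (hW : IsCandidate W w) : BooleanCCC (CandidateBAc W) := by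
  classical
  intro A hbot hdis
  by_contra hA
  have hA₁ : ℵ₁ ≤ #A := by
    rw [← succ_aleph0, Order.succ_le_iff, ← not_le]
    exact fun h => hA (le_aleph0_iff_set_countable.1 h)
  have hex : ∀ k : A, ∃ b : CandidateBA W, b ≠ ⊥ ∧ DedekindCut.principal b ≤ k := fun k =>
    DedekindCut.exists_principal_le fun h => hbot (h ▸ k.2)
  choose b hb hbk using hex
  choose V a haV ha hval using fun k => CandidateBA.exists_trace (hb k)
  let g : A → Set (I × Bool) := fun k => boolGraph (V k : Set I) fun i => decide (i.1 ∈ a k)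
  have hgfin : ∀ k, (g k).Finite := fun k => Set.finite_range _
  have hga : ∀ k i, (i, true) ∈ g k ↔ i ∈ a k := by
    intro k i
    rw [mem_boolGraph]
    simpa using fun h => haV k h
  -- The points of the relations captured by `a k`; the candidate property makes this set finite.
  let Fs : A → Set I := fun k =>
    ⋃ x ∈ {x : W | (x : Finset I) ∩ a k ∈ w x}, ((x : Finset I) : Set I)
  have hFs : ∀ k, (Fs k).Finite := fun k =>
    (hW.finite_cl (a k)).biUnion fun x _ => x.1.finite_toSet
  let E : A → Set (I × Bool) := fun k => contradicting (g k) ∪ (fun i => (i, true)) '' Fs k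
  have hE : ∀ k, (E k).Finite := fun k => ((hgfin k).image _).union ((hFs k).image _)
  obtain ⟨X, r, hX, hr, hXdis⟩ := fewSmallSubsets_aleph_one_aleph0.exists_delta_system
    isRegular_aleph_one isRegular_aleph0 aleph0_lt_aleph_one hA₁ g
    fun k => lt_aleph0_iff_set_finite.2 (hgfin k)
  obtain ⟨Y, hYX, hY, hfree⟩ := fewSmallSubsets_aleph_one_aleph0.exists_free_subset
    isRegular_aleph_one isRegular_aleph0 aleph0_lt_aleph_one hX.ge
    (fun k => {l ∈ X | ¬ Disjoint (E k) (g l \ r)}) fun k _ => by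
      refine ((mk_le_mk_of_subset Set.inter_subset_left).trans
        (mk_setOf_not_disjoint_le hXdis (E k))).trans_lt ?_
      exact lt_aleph0_iff_set_finite.2 (hE k)
  obtain ⟨k, hk, l, hl, hkl⟩ : ∃ k ∈ Y, ∃ l ∈ Y, k ≠ l := by
    have : 1 < #Y := by
      rw [hY]
      exact isRegular_aleph_one.nat_lt 1 |>.trans_eq' (by simp)
    obtain ⟨⟨k, hk⟩, ⟨l, hl⟩, hne⟩ := one_lt_iff_nontrivial.1 this
    exact ⟨k, hk, l, hl, fun h => hne (Subtype.ext h)⟩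
  -- By freeness, `E k` meets `g l` only in the root.
  have hmem : ∀ k ∈ Y, ∀ l ∈ Y, k ≠ l → ∀ x ∈ E k, x ∈ g l → x ∈ g k := by
    intro k hk l hl hkl x hxE hx
    by_contra hxk
    exact hfree hk hl hkl ⟨hYX hl, Set.not_disjoint_iff.2
      ⟨x, hxE, hx, fun hxr => hxk (hr k (hYX hk) hxr)⟩⟩
  have hagree : ∀ i ∈ V k, i ∈ V l → (i ∈ a k ↔ i ∈ a l) := by
    intro i hik hil
    have hd : Disjoint (contradicting (g k)) (g l) := Set.disjoint_left.2 fun x hx hx' =>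
      not_mem_contradicting (hmem k hk l hl hkl x (Or.inl hx) hx') hx
    simpa using eq_of_disjoint_contradicting hd i hik hil
  have hsub : ∀ k ∈ Y, ∀ l ∈ Y, k ≠ l → ∀ x : W, (x : Finset I) ⊆ a k ∪ a l →
      (x : Finset I) ∩ a k ∉ w x := by
    intro k hk l hl hkl x hx hxw
    refine ha k x x.2 fun i hi => ?_
    rcases Finset.mem_union.1 (hx hi) with h | h
    · exact h
    · exact (hga k i).1 (hmem k hk l hl hkl (i, true)
        (Or.inr ⟨i, Set.mem_biUnion hxw hi, rfl⟩) ((hga l i).2 h))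
  have hc : IsAdmissible W ((a k ∪ a l : Finset I) : Set I) := by
    intro u hu huc
    have huc' : u ⊆ a k ∪ a l := by exact_mod_cast huc
    have hp := hW.pfil ⟨u, hu⟩
    -- One of the two traces captures `u`. By `hmem`, a relation inside the union that is captured
    -- by one trace lies wholly in that trace, against its admissibility.
    rcases hp.partition (u ∩ a k) (u \ a k) (Finset.disjoint_sdiff_inter u (a k)).symm
      (by rw [Finset.union_comm]; exact Finset.sdiff_union_inter u (a k)) with h | h
    · exact hsub k hk l hl hkl ⟨u, hu⟩ huc' h
    · refine hsub l hl k hk hkl.symm ⟨u, hu⟩ (by rwa [Finset.union_comm]) ?_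
      refine hp.upward _ h _ (fun i hi => ?_) Finset.inter_subset_left
      have := huc' (Finset.sdiff_subset hi)
      simp only [Finset.mem_sdiff, Finset.mem_union, Finset.mem_inter] at *
      tauto
  have hk1 := hval k _ hc fun i hi => by
    simp only [Finset.coe_union, Set.mem_union, Finset.mem_coe]
    exact ⟨fun h => h.elim id fun h => (hagree i hi (haV l h)).2 h, Or.inl⟩
  have hl1 := hval l _ hc fun i hi => by
    simp only [Finset.coe_union, Set.mem_union, Finset.mem_coe]
    exact ⟨fun h => h.elim (fun h => (hagree i (haV k h) hi).1 h) id, Or.inr⟩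
  have h0 : b k ⊓ b l = ⊥ := by
    have h1 : Disjoint (k : CandidateBAc W) l := hdis k.2 l.2 fun h => hkl (Subtype.ext h)
    by_contra hne
    refine DedekindCut.principal_ne_bot hne (le_bot_iff.1 ?_)
    rw [DedekindCut.principal_inf]
    exact h1.le_bot.trans' (inf_le_inf (hbk k) (hbk l))
  have h2 := congrArg (fun q => CandidateRing.evalAt hc (ofBoolAlg q)) h0
  simp only [ofBoolAlg_inf, map_mul, ofBoolAlg_bot, map_zero, mul_eq_zero] at h2
  exact h2.elim hk1 hl1

/-! ### Candidates made of cones. -/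

/-- The pseudo-filter on `insert p a` generated by `a` and the pairs `{p, y}` with `y ∈ a`. -/
def conePseudoFilter {I : Type u} [DecidableEq I] (a : Finset I) (p : I) : Set (Finset I) :=
  {v | v ⊆ insert p a ∧ (a ⊆ v ∨ p ∈ v ∧ ∃ y ∈ a, y ∈ v)}

/-- In a partition, the part with the apex either meets `a` or leaves all of `a` to the other part.
-/
theorem isPseudoFilter_conePseudoFilter {I : Type u} [DecidableEq I] {a : Finset I} {p : I} :
    IsPseudoFilter (insert p a) (conePseudoFilter a p) where
  subset _ hv := hv.1
  self_mem := ⟨subset_rfl, Or.inl (Finset.subset_insert p a)⟩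
  upward v hv v' hvv' hv' := ⟨hv', hv.2.imp (fun h => h.trans hvv')
    fun ⟨h, y, hy, hyv⟩ => ⟨hvv' h, y, hy, hvv' hyv⟩⟩
  partition := by
    have key : ∀ u₁ u₂ : Finset I, u₁ ∪ u₂ = insert p a → p ∈ u₁ →
        u₁ ∈ conePseudoFilter a p ∨ u₂ ∈ conePseudoFilter a p := by
      intro u₁ u₂ h hp
      by_cases hy : ∃ y ∈ a, y ∈ u₁
      · exact Or.inl ⟨h ▸ Finset.subset_union_left, Or.inr ⟨hp, hy⟩⟩
      · push Not at hy
        refine Or.inr ⟨h ▸ Finset.subset_union_right, Or.inl fun y hya => ?_⟩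
        have : y ∈ u₁ ∪ u₂ := h ▸ Finset.mem_insert_of_mem hya
        exact (Finset.mem_union.1 this).resolve_left (hy y hya)
    intro u₁ u₂ _ h
    have hp : p ∈ u₁ ∪ u₂ := h ▸ Finset.mem_insert_self p a
    rcases Finset.mem_union.1 hp with hp | hp
    · exact key u₁ u₂ h hp
    · exact (key u₂ u₁ (by rw [Finset.union_comm, h]) hp).symm

/-- A family of cones over finite sets is a candidate if each finite set contains finitely many of the
bases, and there are finitely many cones with a given apex and a given point in the base. -/
theorem exists_isCandidate_range {I ι : Type u} [DecidableEq I] (a : ι → Finset I) (p : ι → I)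
    (h₁ : ∀ v : Finset I, {x | a x ⊆ v}.Finite)
    (h₂ : ∀ y z, {x | y ∈ a x ∧ p x = z}.Finite) :
    ∃ w : Set.range (fun x => insert (p x) (a x)) → Set (Finset I), IsCandidate _ w := by
  choose c hc using fun u : Set.range (fun x => insert (p x) (a x)) => u.2
  refine ⟨fun u => conePseudoFilter (a (c u)) (p (c u)), fun u => ?_, fun v => ?_⟩
  · have := isPseudoFilter_conePseudoFilter (a := a (c u)) (p := p (c u))
    rwa [show insert (p (c u)) (a (c u)) = u.1 from hc u] at this
  · have hfin : ({x | a x ⊆ v} ∪ ⋃ y ∈ v, ⋃ z ∈ v, {x | y ∈ a x ∧ p x = z}).Finite :=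
      (h₁ v).union (v.finite_toSet.biUnion fun y _ => v.finite_toSet.biUnion fun z _ => h₂ y z)
    refine Set.Finite.of_finite_image (f := c) (hfin.subset ?_) fun u _ u' _ h => ?_
    · rintro _ ⟨u, ⟨-, hu | ⟨hu, y, hy, hyv⟩⟩, rfl⟩
      · exact Or.inl (hu.trans Finset.inter_subset_right)
      · refine Or.inr (Set.mem_biUnion (Finset.mem_inter.1 hyv).2 ?_)
        exact Set.mem_biUnion (Finset.mem_inter.1 hu).2 ⟨hy, rfl⟩
    · exact Subtype.ext ((hc u).symm.trans ((by rw [h]) : _ = _) |>.trans (hc u'))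

theorem CandidateBAc.exists_strictMono_iInf_eq_bot {I : Type u} [LinearOrder I]
    {W : Set (Finset I)} {a : Finset I} (ha : a ∈ W) :
    ∃ s : Fin a.card → I, StrictMono s ∧ (∀ k, s k ∈ a) ∧ ⨅ k, CandidateBAc.gen W (s k) = ⊥ := by
  refine ⟨a.orderEmbOfFin rfl, (a.orderEmbOfFin rfl).strictMono,
    fun k => a.orderEmbOfFin_mem rfl k, ?_⟩
  refine le_bot_iff.1 ((CandidateBAc.inf_gen_eq_bot ha).le.trans' (le_iInf₂ fun i hi => ?_))
  obtain ⟨k, rfl⟩ : i ∈ Set.range (a.orderEmbOfFin rfl) := by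
    rw [Finset.range_orderEmbOfFin]
    exact hi
  exact iInf_le _ k

theorem disjoint_contradicting_comm {I : Type u} {g h : Set (I × Bool)}
    (hd : Disjoint (contradicting g) h) : Disjoint (contradicting h) g := by
  rw [Set.disjoint_left] at hd ⊢
  rintro _ ⟨x, hx, rfl⟩ hx'
  exact hd ⟨_, hx', rfl⟩ (by simpa using hx)

open Cardinal in
theorem mk_lt_aleph_one_iff {J : Type u} {s : Set J} : #s < ℵ₁ ↔ s.Countable := by
  rw [← succ_aleph0, Order.lt_succ_iff, le_aleph0_iff_set_countable]

/-! ### The block hypergraph and its compatible edges. -/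

/-- The data of an edge in the hypergraph on `I`, where `I` is partitioned into blocks indexed by
pairs `(b, z)`: a block with `b` injective, a finite subset of the block, and a label. -/
structure BlockEdge {M : Type u} (Φ : Finset M → Finset M) (I : Type u) where
  block : (Finset M × M → I) × I
  label : Finset M × M
  injective : Function.Injective block.1
  two_le : 2 ≤ label.1.card
  mem : label.2 ∈ Φ label.1

namespace BlockEdge

variable {M I : Type u} {Φ : Finset M → Finset M}

theorem ext_iff' {x y : BlockEdge Φ I} : x = y ↔ x.block = y.block ∧ x.label = y.label := by
  cases x
  cases y
  simp

/-- The part of the edge inside its block. -/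
def base [DecidableEq I] (e : ((Finset M × M → I) × I) × M ≃ I) (x : BlockEdge Φ I) : Finset I :=
  x.label.1.image fun i => e (x.block, i)

/-- The additional point of the edge. -/
def apex (x : BlockEdge Φ I) : I := x.block.1 x.label

theorem block_eq_of_mem_base [DecidableEq I] {e : ((Finset M × M → I) × I) × M ≃ I}
    {x : BlockEdge Φ I} {y : I} (hy : y ∈ x.base e) : x.block = (e.symm y).1 := by
  obtain ⟨i, -, rfl⟩ := Finset.mem_image.1 hy
  simp

theorem card_base [DecidableEq I] (e : ((Finset M × M → I) × I) × M ≃ I) (x : BlockEdge Φ I) :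
    (x.base e).card = x.label.1.card :=
  Finset.card_image_of_injective _ fun i j h => by simpa using h

/-- The points of `v` leave finitely many blocks and finitely many `s`, and `Φ s` is finite. -/
theorem finite_base_subset [DecidableEq I] (e : ((Finset M × M → I) × I) × M ≃ I)
    (v : Finset I) : {x : BlockEdge Φ I | x.base e ⊆ v}.Finite := by
  classical
  let B := v.image fun y => (e.symm y).1
  let S := (v.image fun y => (e.symm y).2).powerset
  have hfin : ((B : Set ((Finset M × M → I) × I)) ×ˢ
      ⋃ s ∈ S, (fun ξ => (s, ξ)) '' (Φ s : Set M)).Finite :=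
    B.finite_toSet.prod (S.finite_toSet.biUnion fun s _ => (Φ s).finite_toSet.image _)
  refine Set.Finite.of_finite_image (f := fun x => (x.block, x.label)) (hfin.subset ?_) ?_
  · rintro _ ⟨x, hx, rfl⟩
    have hx' : x.base e ⊆ v := hx
    refine ⟨?_, ?_⟩
    · obtain ⟨y, hy⟩ : (x.base e).Nonempty :=
        Finset.card_pos.1 (by rw [card_base]; exact two_pos.trans_le x.two_le)
      exact Finset.mem_image.2 ⟨y, hx' hy, (block_eq_of_mem_base hy).symm⟩
    · refine Set.mem_biUnion (x := x.label.1) ?_ ⟨x.label.2, x.mem, rfl⟩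
      refine Finset.mem_powerset.2 fun i hi => Finset.mem_image.2 ⟨e (x.block, i), ?_, by simp⟩
      exact hx' (Finset.mem_image_of_mem _ hi)
  · intro x _ y _ h
    exact ext_iff'.2 (Prod.ext_iff.1 h)

/-- The base point determines the block, and injectivity of its function recovers the label from the
apex. -/
theorem finite_mem_base_apex_eq [DecidableEq I] (e : ((Finset M × M → I) × I) × M ≃ I)
    (y z : I) : {x : BlockEdge Φ I | y ∈ x.base e ∧ x.apex = z}.Finite := by
  refine Set.Subsingleton.finite ?_
  rintro x ⟨hx, hxz⟩ x' ⟨hx', hxz'⟩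
  have hb : x.block = x'.block := (block_eq_of_mem_base hx).trans (block_eq_of_mem_base hx').symm
  refine ext_iff'.2 ⟨hb, x.injective (hxz.trans ?_)⟩
  rw [← hxz', apex, hb]

open Cardinal in
/-- Every coloring of `I` by countable partial functions has an edge with compatible colors. -/
theorem exists_compatible [DecidableEq I] {μ : Cardinal.{u}} (hμ : μ.IsRegular) (hμ₁ : ℵ₁ < μ)
    (hsmall : FewSmallSubsets μ ℵ₁) (hM : #M = μ) (hI : μ < #I)
    (hΦ : ∀ X : Set M, #X = μ → ∀ ξ, ∃ s : Finset M, ↑s ⊆ X ∧ 2 ≤ s.card ∧ ξ ∈ Φ s)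
    (e : ((Finset M × M → I) × I) × M ≃ I) (g : I → Set (I × Bool))
    (hg : ∀ i, (g i).Countable) (hgg : ∀ i, Disjoint (contradicting (g i)) (g i)) :
    ∃ x : BlockEdge Φ I, ∀ k ∈ insert x.apex (x.base e), ∀ l ∈ insert x.apex (x.base e),
      Disjoint (contradicting (g k)) (g l) := by
  classical
  have hμ₀ := hμ.aleph0_le
  have hsucc := isRegular_succ hμ₀
  have hsmall' := fewSmallSubsets_succ hμ hμ₁ hsmall
  have : Infinite M := infinite_iff.2 (hM ▸ hμ₀)
  choose T hT using exists_isSunflowerOver μ g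
  obtain ⟨U, hU, hclosed⟩ := hsmall'.exists_closed hsucc isRegular_aleph_one
    (hμ₁.trans (Order.lt_succ μ)) (fun p => ⋃ l : T p, g l) fun p _ =>
      mk_iUnion_lt_of_isRegular hsucc (Order.lt_succ_of_le (hT p).mk_le) fun l =>
        (mk_lt_aleph_one_iff.2 (hg l)).trans (hμ₁.trans (Order.lt_succ μ))
  let P := {p : Set (I × Bool) // p ⊆ U ∧ #p < ℵ₁}
  have hP : #P ≤ #M := by
    rw [hM, ← Order.lt_succ_iff]
    exact hsmall' _ U hU
  have : Nonempty P := ⟨⟨∅, Set.empty_subset U, mk_lt_aleph_one_iff.2 Set.countable_empty⟩⟩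
  obtain ⟨c⟩ := hP
  let d : M → P := Function.invFun c
  have hd : Function.Surjective d := Function.invFun_surjective c.injective
  -- `Set.univ` is a dummy value that makes every set large enough for distinct representatives.
  let T' : M → Set I := fun ξ => if #(T (d ξ)) = μ then T (d ξ) else Set.univ
  have hT' : ∀ ξ, μ ≤ #(T' ξ) := by
    intro ξ
    by_cases h : #(T (d ξ)) = μ
    · simp only [T', if_pos h]
      exact h.ge
    · simp only [T', if_neg h, mk_univ]
      exact hI.le
  have hK : #(Finset M × M) = μ := by
    rw [mk_prod, lift_id, lift_id, mk_finset_of_infinite, hM, mul_eq_self hμ₀]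
  obtain ⟨b, hb, hbT⟩ := exists_injective_choice (fun k : Finset M × M => T' k.2)
    fun k => hK.le.trans (hT' k.2)
  have hE : #(⋃ p : P, T p.1) < Order.succ μ :=
    hsmall'.mk_iUnion_lt hsucc hU fun p _ => Order.lt_succ_of_le (hT p).mk_le
  -- Copies with different `z` are disjoint, and the sunflowers cover at most μ < λ points. Avoiding
  -- them lets maximality apply to block points.
  obtain ⟨z, hz⟩ : ∃ z, ∀ i, e ((b, z), i) ∉ ⋃ p : P, T p.1 := by
    by_contra! hall
    choose i hi using hall
    have : #I ≤ #(⋃ p : P, T p.1) := by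
      refine ⟨⟨fun z => ⟨_, hi z⟩, fun z z' h => ?_⟩⟩
      have := e.injective (congrArg Subtype.val h)
      simp only [Prod.mk.injEq] at this
      exact this.1.2
    exact absurd (this.trans (Order.lt_succ_iff.1 hE)) (not_le.2 hI)
  let y : M → I := fun i => e ((b, z), i)
  obtain ⟨X, r, hX, hr, hXdis⟩ := hsmall.exists_delta_system hμ isRegular_aleph_one hμ₁ hM.ge
    (fun i => g (y i)) fun i => mk_lt_aleph_one_iff.2 (hg _)
  have hXne : X.Nonempty := by
    rw [← Set.nonempty_coe_sort, ← mk_ne_zero_iff, hX]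
    exact hμ.ne_zero
  have hrc : r.Countable := by
    obtain ⟨i, hi⟩ := hXne
    exact (hg _).mono (hr i hi)
  obtain ⟨ξ, hξ⟩ := hd ⟨r ∩ U, Set.inter_subset_right,
    mk_lt_aleph_one_iff.2 (hrc.mono Set.inter_subset_left)⟩
  set p := r ∩ U with hp
  have hpr : ∀ i ∈ X, p ⊆ g (y i) := fun i hi => Set.inter_subset_left.trans (hr i hi)
  -- Otherwise, by maximality, each block point of `X` shares with some `g l`, `l ∈ T p`, an element
  -- outside `p`. It lies in `U`, hence outside `r`, so μ disjoint petals would meet a set of size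
  -- less than μ.
  have hTp : #(T p) = μ := by
    by_contra hne
    have hlt := lt_of_le_of_ne (hT p).mk_le hne
    have hS : #(⋃ l : T p, g l) < μ := mk_iUnion_lt_of_isRegular hμ hlt fun l =>
      (mk_lt_aleph_one_iff.2 (hg l)).trans hμ₁
    refine absurd ((mk_setOf_not_disjoint_le hXdis (⋃ l : T p, g l)).trans_lt hS) (not_lt.2 ?_)
    rw [← hX]
    refine mk_le_mk_of_subset fun i hi => ⟨hi, ?_⟩
    have hpc : #p < ℵ₁ := mk_lt_aleph_one_iff.2 (hrc.mono Set.inter_subset_left)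
    have hiT : y i ∉ T p := fun h =>
      hz i (Set.mem_iUnion.2 ⟨⟨p, Set.inter_subset_right, hpc⟩, h⟩)
    obtain ⟨l, hl, hdis⟩ := (hT p).maximal hlt _ hiT (hpr i hi)
    obtain ⟨x, hx, hx'⟩ := Set.not_disjoint_iff.1 hdis
    have hxS : x ∈ ⋃ l : T p, g l := Set.mem_iUnion.2 ⟨⟨l, hl⟩, hx'.1⟩
    have hxU : x ∈ U := hclosed p Set.inter_subset_right hpc hxS
    exact Set.not_disjoint_iff.2 ⟨x, hxS, hx.1, fun hxr => hx.2 ⟨hxr, hxU⟩⟩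
  have hbp : ∀ s, b (s, ξ) ∈ T p := by
    intro s
    have := hbT (s, ξ)
    simp only [T', hξ] at this
    rwa [if_pos hTp] at this
  let C : M → Set (I × Bool) := fun i => contradicting (g (y i))
  have hC : ∀ i, (C i).Countable := fun i => (hg _).image _
  -- The sets `s` whose apex may clash with the point `i`: countably many, as petals are disjoint
  -- and `b` is injective.
  let D : M → Set (Finset M) := fun i =>
    {s | b (s, ξ) ∈ {l ∈ T p | ¬ Disjoint (C i) (g l \ p)}}
  have hD : ∀ i, (D i).Countable := by
    intro i
    refine Set.Countable.preimage_of_injOn (f := fun s => b (s, ξ)) ?_ ?_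
    · exact mk_lt_aleph_one_iff.1 ((mk_setOf_not_disjoint_le (hT p).disjoint (C i)).trans_lt
        (mk_lt_aleph_one_iff.2 (hC i)))
    · exact fun s _ t _ h => (Prod.ext_iff.1 (hb h)).1
  obtain ⟨Y, hYX, hY, hfree⟩ := hsmall.exists_free_subset hμ isRegular_aleph_one hμ₁ hX.ge
    (fun i => {j ∈ X | ¬ Disjoint (C i) (g (y j) \ r)} ∪ ⋃ s ∈ D i, (s : Set M)) fun i _ => by
      refine mk_lt_aleph_one_iff.2 (Set.Countable.mono Set.inter_subset_left ?_)
      refine Set.Countable.union ?_ ((hD i).biUnion fun s _ => s.countable_toSet)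
      exact mk_lt_aleph_one_iff.1 ((mk_setOf_not_disjoint_le hXdis (C i)).trans_lt
        (mk_lt_aleph_one_iff.2 (hC i)))
  obtain ⟨s, hsY, hs, hsξ⟩ := hΦ Y hY ξ
  have hnot : ∀ i, ∀ x ∈ C i, x ∉ g (y i) := fun i x hx => Set.disjoint_left.1 (hgg (y i)) hx
  have hblock : ∀ i ∈ s, ∀ j ∈ s, Disjoint (C i) (g (y j)) := by
    intro i hi j hj
    rcases eq_or_ne i j with rfl | hij
    · exact hgg (y i)
    · refine Set.disjoint_left.2 fun x hx hxj => hfree (hsY hi) (hsY hj) hij (Or.inl ?_)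
      refine ⟨hYX (hsY hj), Set.not_disjoint_iff.2 ⟨x, hx, hxj, fun hxr => ?_⟩⟩
      exact hnot i x hx (hr i (hYX (hsY hi)) hxr)
  have hapex : ∀ i ∈ s, Disjoint (C i) (g (b (s, ξ))) := by
    intro i hi
    -- Freeness only excludes indices other than `i`, hence the need for a second element of `s`: a
    -- clash would put `j` in the exceptional set of `i`.
    obtain ⟨j, hj, hij⟩ := Finset.exists_mem_ne hs i
    refine Set.disjoint_left.2 fun x hx hxb => hfree (hsY hi) (hsY hj) hij.symm (Or.inr ?_)
    refine Set.mem_biUnion (x := s) ⟨hbp s, Set.not_disjoint_iff.2 ⟨x, hx, hxb, fun hxp => ?_⟩⟩ hj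
    exact hnot i x hx (hpr i (hYX (hsY hi)) hxp)
  refine ⟨⟨(b, z), (s, ξ), hb, hs, hsξ⟩, ?_⟩
  simp only [Finset.mem_insert, base, Finset.mem_image]
  rintro k (rfl | ⟨i, hi, rfl⟩) l (rfl | ⟨j, hj, rfl⟩)
  · exact hgg _
  · exact disjoint_contradicting_comm (hapex j hj)
  · exact hapex i hi
  · exact hblock i hi j hj

end BlockEdge

/-! ### Assembly of the theorem. -/

open Cardinal in
theorem HasJonssonAlgebra.exists_isCandidate_noLiftingHypotheses {μ lam : Cardinal.{u}}
    (hJ : HasJonssonAlgebra μ) (hlam : lam = 2 ^ μ) (hμ : μ.IsRegular)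
    (hpow : ∀ ν < μ, ν ^ (ℵ₀ : Cardinal.{u}) < μ) :
    ∃ (W : Set (Finset lam.ord.ToType)) (w : W → Set (Finset lam.ord.ToType)),
      IsCandidate W w ∧ NoLiftingHypotheses (CandidateBAc W) (CandidateBAc.gen W) := by
  have hμ₀ := hμ.aleph0_le
  have hμc : 2 ^ (ℵ₀ : Cardinal.{u}) < μ := hpow 2 (by simpa using hμ.nat_lt 2)
  have hμ₁ : ℵ₁ < μ := by
    refine lt_of_le_of_lt ?_ hμc
    rw [← succ_aleph0, Order.succ_le_iff]
    exact cantor _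
  have hsmall : FewSmallSubsets μ ℵ₁ :=
    fewSmallSubsets_of_power_lt ((cantor _).trans hμc) hpow
  obtain ⟨Φ, hΦ⟩ := hJ.exists_set_mapping hμ₀
  let M := μ.ord.ToType
  let I := lam.ord.ToType
  have hM : #M = μ := mk_ord_toType μ
  have hI : #I = 2 ^ μ := (mk_ord_toType lam).trans hlam
  have hμI : μ < #I := hI ▸ cantor μ
  have : Infinite M := infinite_iff.2 (hM ▸ hμ₀)
  have he : #(((Finset M × M → I) × I) × M) = #I := by
    have hI₀ : ℵ₀ ≤ #I := hμ₀.trans hμI.le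
    simp only [mk_prod, lift_id, mk_pi, prod_const, mk_finset_of_infinite, hM, mul_eq_self hμ₀]
    -- This is what allows every function `b` to index blocks inside λ itself.
    have h1 : #I ^ μ = #I := by rw [hI, ← power_mul, mul_eq_self hμ₀]
    rw [h1, mul_eq_self hI₀, mul_eq_left hI₀ hμI.le hμ.ne_zero]
  obtain ⟨e⟩ := Cardinal.eq.1 he
  obtain ⟨w, hw⟩ := exists_isCandidate_range (fun x : BlockEdge Φ I => x.base e)
    BlockEdge.apex (BlockEdge.finite_base_subset e) (BlockEdge.finite_mem_base_apex_eq e)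
  refine ⟨_, w, hw, hw.ccc, fun i => CandidateBAc.gen_ne_bot ?_, fun v f hv => ?_⟩
  · rintro _ ⟨x, rfl⟩ hx
    have h1 : x.base e ⊆ {i} := fun j hj => by
      simpa using hx (Finset.mem_coe.2 (Finset.mem_insert_of_mem hj))
    have h2 := Finset.card_le_card h1
    rw [BlockEdge.card_base, Finset.card_singleton] at h2
    exact absurd (x.two_le.trans h2) (by norm_num)
  · obtain ⟨x, hx⟩ := BlockEdge.exists_compatible hμ hμ₁ hsmall hM hμI hΦ e
      (fun i => boolGraph (v i) (f i))
      (fun i => by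
        have := (hv i).to_subtype
        exact Set.countable_range _)
      fun i => Set.disjoint_left.2 fun y hy hy' => not_mem_contradicting hy' hy
    obtain ⟨s, hs, hsm, hbot⟩ := CandidateBAc.exists_strictMono_iInf_eq_bot
      (W := Set.range fun x : BlockEdge Φ I => insert x.apex (x.base e)) ⟨x, rfl⟩
    refine ⟨_, s, Finset.card_pos.2 (Finset.insert_nonempty _ _), hs, fun k l a hk hl => ?_, hbot⟩
    exact eq_of_disjoint_contradicting (hx _ (hsm k) _ (hsm l)) a hk hl

theorem theorem1p7 (μ lam : Cardinal.{u}) (hJ : HasJonssonAlgebra μ) (hlam : lam = 2 ^ μ)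
    (hμ : μ.IsRegular)
    (hpow : ∀ α : Ordinal.{u}, α < μ.ord → α.card ^ Cardinal.aleph0.{u} < μ) :
    ∃ (W : Set (Finset lam.ord.ToType)) (w : W → Set (Finset lam.ord.ToType)),
      IsCandidate W w ∧ NoLiftingHypotheses (CandidateBAc W) (CandidateBAc.gen W) := by
  refine hJ.exists_isCandidate_noLiftingHypotheses hlam hμ fun ν hν => ?_
  simpa using hpow ν.ord (Cardinal.ord_lt_ord.2 hν)
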